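/- **Setting.** Let $\Omega,\Theta,\mathcal A$ be finite sets of outcomes ($m=|\Omega|$), agent types and agent actions. For $\theta\in\Theta$, $a\in\mathcal A$ let $F_{\theta,a}\in\Delta_\Omega$ be a probability distribution over outcomes and $c_{\theta,a}\in[0,1]$ a cost; let $r\in[0,1]^\Omega$ be the principal's rewards and $\lambda\in\Delta_\Theta$ the distribution of the agent's type. Every type $\theta$ has an opt-out action $a$ with $c_{\theta,a}=0$ and $F_{\theta,a}\cdot r=0$. For a contract $p\in\mathbb R_{\ge 0}^{\Omega}$ let $u^{\mathsf A}(p,a,\theta)=F_{\theta,a}\cdot p-c_{\theta,a}$ and $u^{\mathsf P}(p,a,\theta)=F_{\theta,a}\cdot(r-p)$ be the expected utilities of the agent and of the principal. Let $A^\theta(p)=\arg\max_{a}u^{\mathsf A}(p,a,\theta)$ be the set of best responses and, for $\delta\in(0,1)$, let $A^{\theta,\delta}(p)=\{a: u^{\mathsf A}(p,a,\theta)>\max_{a'}u^{\mathsf A}(p,a',\theta)-\delta\}$ be the set of $\delta$-best responses. Fix selections $a^\theta(p)\in\arg\max_{a\in A^\theta(p)}u^{\mathsf P}(p,a,\theta)$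 and $a^{\theta,\delta}(p)\in\arg\min_{a\in A^{\theta,\delta}(p)}u^{\mathsf P}(p,a,\theta)$, and let $\mathcal C=[0,1]^{\Omega}$. **Interaction.** In each round $t=1,\dots,T$ a type $\theta^t\sim\lambda$ is drawn independently of the past, the principal commits to a contract $p^t\in\mathcal C$ without observing $\theta^t$, the agent plays $a^{\theta^t,\delta}(p^t)$, and the principal observes only the outcome $\omega^t\sim F_{\theta^t,a^{\theta^t,\delta}(p^t)}$, thus receiving the payoff $r_{\omega^t}-p^t_{\omega^t}$. **Algorithm.** Given $T\ge 1$, let $\epsilon=T^{-1/(m+1)}$ and let $\mathcal B_\epsilon=\{p\in[0,1]^\Omega : p_\omega\in\{0,\epsilon,2\epsilon,\dots\}\cup\{1\}\ \forall\omega\in\Omega\}$. Run UCB1 with $\mathcal B_\epsilon$ as set of arms, the payoffs being rescaled from $[-1,1]$ to $[0,1]$ by $x\mapsto(1+x)/2$: while some arm has not been played, play such an arm; afterwards, if $N$ rounds have been played so far, $N_p$ of them with arm $p$ and with average rescaled payoff $\bar x_p$, play an arm that maximizes $\bar x_p+\sqrt{2\ln N/N_p}$. Ties are broken by an arbitrary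 deterministic rule based on the past observations. **Regret.** With $\mathrm{OPT}(\mathcal C)=\max_{p\in\mathcal C}\sum_{\theta}\lambda_\theta u^{\mathsf P}(p,a^\theta(p),\theta)$ let $$R_T(\mathcal C)=T\cdot\mathrm{OPT}(\mathcal C)-\mathbb E\Big[\sum_{t=1}^{T}\sum_{\theta\in\Theta}\lambda_\theta\,u^{\mathsf P}(p^t,a^{\theta,\delta}(p^t),\theta)\Big].$$ **Statement.** 1. There is an absolute constant $k\in\mathbb N$ such that for every $m$ there is a constant $C$, depending only on $m$, such that for every instance with $m$ outcomes, every $\delta\in(0,1)$, all selections and tie-breaking rules as above, and every $T\ge1$, $$R_T(\mathcal C)\le C\,T^{1-\frac1{2(m+1)}}(1+\ln T)^k+2\sqrt\delta\,T .$$ That is, $R_T(\mathcal C)\le\widetilde{\mathcal O}\big(T^{1-\frac{1}{2(m+1)}}\big)+2\sqrt\delta\,T$. 2. Consequently, for every $\alpha>0$ and $\delta=T^{-\alpha}$, the regret is sublinear: for all $m$, $\alpha>0$ and $\eta>0$ there is $T_0$ such that $|R_T(\mathcal C)|\le\eta T$ for every $T\ge T_0$, every instance with $m$ outcomes, and all selections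 and tie-breaking rules as above with $\delta=T^{-\alpha}$. -/

import Mathlib

/-- A hidden-action principal-agent problem with finitely many outcomes `Ω`, agent types `Θ` and
agent actions `A`. -/
structure PrincipalAgent (Ω Θ A : Type*) [Fintype Ω] [Fintype Θ] where
  /-- `F θ a` is the distribution over outcomes induced by action `a` of an agent of type `θ`. -/
  F : Θ → A → Ω → ℝ
  F_mem : ∀ θ a, F θ a ∈ stdSimplex ℝ Ω
  /-- the principal's reward for each outcome -/
  r : Ω → ℝ
  r_mem : ∀ ω, r ω ∈ Set.Icc (0 : ℝ) 1
  /-- the agent's cost of an action -/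
  c : Θ → A → ℝ
  c_mem : ∀ θ a, c θ a ∈ Set.Icc (0 : ℝ) 1
  /-- the distribution of the agent's type -/
  lam : Θ → ℝ
  lam_mem : lam ∈ stdSimplex ℝ Θ
  /-- every type has an opt-out action, with null cost and null expected reward -/
  opt_out : ∀ θ, ∃ a, c θ a = 0 ∧ ∑ ω, F θ a ω * r ω = 0

/-- The contracts available to the principal: the hypercube `[0,1]^Ω`. -/
def contractCube (Ω : Type*) : Set (Ω → ℝ) := {p | ∀ ω, p ω ∈ Set.Icc (0 : ℝ) 1}

/-- The uniform grid of step `ε` on the hypercube: every payment belongs to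
`{0, ε, 2ε, …} ∩ [0,1]` or is equal to `1`. -/
def contractGrid (Ω : Type*) (ε : ℝ) : Set (Ω → ℝ) :=
  {p | ∀ ω, (∃ k : ℕ, p ω = k * ε ∧ p ω ≤ 1) ∨ p ω = 1}

/-- What the principal observes in past rounds: the list of pairs (contract, realized outcome),
the most recent round first. -/
abbrev ObsHistory (Ω : Type*) := List ((Ω → ℝ) × Ω)

/-- A learning algorithm of the principal: the next contract, given the observations so far. -/
abbrev ContractPolicy (Ω : Type*) := ObsHistory Ω → (Ω → ℝ)

namespace PrincipalAgent

variable {Ω Θ A : Type*} [Fintype Ω] [Fintype Θ]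

/-- The agent's expected utility. -/
def agentUtility (G : PrincipalAgent Ω Θ A) (θ : Θ) (p : Ω → ℝ) (a : A) : ℝ :=
  ∑ ω, G.F θ a ω * p ω - G.c θ a

/-- The principal's expected utility. -/
def principalUtility (G : PrincipalAgent Ω Θ A) (θ : Θ) (p : Ω → ℝ) (a : A) : ℝ :=
  ∑ ω, G.F θ a ω * (G.r ω - p ω)

/-- The set of exact best responses of type `θ` to the contract `p`. -/
def bestResponses (G : PrincipalAgent Ω Θ A) (θ : Θ) (p : Ω → ℝ) : Set A :=
  {a | ∀ a', G.agentUtility θ p a' ≤ G.agentUtility θ p a}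

/-- The set of `δ`-best responses of type `θ` to the contract `p` (strict inequality; the maximum
over the finitely many actions is expressed by quantifying over all of them). -/
def approxBestResponses (G : PrincipalAgent Ω Θ A) (δ : ℝ) (θ : Θ) (p : Ω → ℝ) : Set A :=
  {a | ∀ a', G.agentUtility θ p a' - δ < G.agentUtility θ p a}

/-- `a₀ θ p` is, for every type and every contract with nonnegative payments, an exact best
response, with ties broken in favour of the principal. -/
def IsFavorableResponse (G : PrincipalAgent Ω Θ A) (a₀ : Θ → (Ω → ℝ) → A) : Prop :=
  ∀ θ p, (∀ ω, 0 ≤ p ω) → a₀ θ p ∈ G.bestResponses θ p ∧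
    ∀ a ∈ G.bestResponses θ p, G.principalUtility θ p a ≤ G.principalUtility θ p (a₀ θ p)

/-- `aδ θ p` is, for every type and every contract with nonnegative payments, a `δ`-best response
that is worst for the principal. -/
def IsRobustResponse (G : PrincipalAgent Ω Θ A) (δ : ℝ) (aδ : Θ → (Ω → ℝ) → A) : Prop :=
  ∀ θ p, (∀ ω, 0 ≤ p ω) → aδ θ p ∈ G.approxBestResponses δ θ p ∧
    ∀ a ∈ G.approxBestResponses δ θ p,
      G.principalUtility θ p (aδ θ p) ≤ G.principalUtility θ p a

/-- The principal's expected utility from the contract `p`, over the random type, when every type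
responds according to `resp`. -/
def expectedUtility (G : PrincipalAgent Ω Θ A) (resp : Θ → (Ω → ℝ) → A) (p : Ω → ℝ) : ℝ :=
  ∑ θ, G.lam θ * G.principalUtility θ p (resp θ p)

/-- The value of an optimal contract in the hypercube, when the agent responds according to
`resp`. For favorable exact best responses the supremum is a maximum, see `opt_isGreatest`. -/
noncomputable def opt (G : PrincipalAgent Ω Θ A) (resp : Θ → (Ω → ℝ) → A) : ℝ :=
  sSup (G.expectedUtility resp '' contractCube Ω)

/-- With favorable exact best responses, the value `opt` is attained. -/
theorem opt_isGreatest [Finite A] (G : PrincipalAgent Ω Θ A) (a₀ : Θ → (Ω → ℝ) → A)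
    (h₀ : G.IsFavorableResponse a₀) :
    IsGreatest (G.expectedUtility a₀ '' contractCube Ω) (G.opt a₀) := by
  have hcube : contractCube Ω = Set.univ.pi (fun _ : Ω => Set.Icc (0 : ℝ) 1) := by
    ext p; simp only [contractCube, Set.mem_ofPred_eq, Set.mem_univ_pi]
  have hcpt : IsCompact (contractCube Ω) := by
    rw [hcube]; exact isCompact_univ_pi fun _ => isCompact_Icc
  have hne : (contractCube Ω).Nonempty := ⟨fun _ => 0, fun _ => by simp⟩
  have hA : ∀ θ a, Continuous fun p => G.agentUtility θ p a := fun θ a => by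
    unfold agentUtility; fun_prop
  have hP : ∀ θ a, Continuous fun p => G.principalUtility θ p a := fun θ a => by
    unfold principalUtility; fun_prop
  have husc : ∀ θ, UpperSemicontinuousOn
      (fun p => G.lam θ * G.principalUtility θ p (a₀ θ p)) (contractCube Ω) := by
    intro θ p hp y hy
    have key : ∀ a, ∀ᶠ q in nhdsWithin p (contractCube Ω), a₀ θ q = a →
        G.lam θ * G.principalUtility θ q a < y := by
      intro a
      by_cases ha : a ∈ G.bestResponses θ p
      · have h1 : G.lam θ * G.principalUtility θ p a < y :=
          lt_of_le_of_lt (mul_le_mul_of_nonneg_left ((h₀ θ p fun ω => (hp ω).1).2 a ha)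
            (G.lam_mem.1 θ)) hy
        have h2 : Continuous fun q => G.lam θ * G.principalUtility θ q a :=
          continuous_const.mul (hP θ a)
        filter_upwards [nhdsWithin_le_nhds ((h2.tendsto p).eventually (gt_mem_nhds h1))]
          with q hq _ using hq
      · simp only [bestResponses, Set.mem_ofPred_eq, not_forall, not_le] at ha
        obtain ⟨b, hb⟩ := ha
        have h3 : ∀ᶠ q in nhds p, G.agentUtility θ q a < G.agentUtility θ q b :=
          (hA θ a).continuousAt.eventually_lt (hA θ b).continuousAt hb
        filter_upwards [nhdsWithin_le_nhds h3, self_mem_nhdsWithin] with q hq hqc hqa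
        have := (h₀ θ q fun ω => (hqc ω).1).1 b
        rw [hqa] at this
        exact absurd hq (not_lt.mpr this)
    filter_upwards [Filter.eventually_all.2 key] with q hq using hq _ rfl
  have hsum : UpperSemicontinuousOn (G.expectedUtility a₀) (contractCube Ω) := by
    have := upperSemicontinuousOn_sum (s := contractCube Ω) (a := Finset.univ)
      (f := fun θ p => G.lam θ * G.principalUtility θ p (a₀ θ p)) (fun θ _ => husc θ)
    exact this
  obtain ⟨p, hp, hmax⟩ := hsum.exists_isMaxOn hne hcpt
  have hg : IsGreatest (G.expectedUtility a₀ '' contractCube Ω) (G.expectedUtility a₀ p) :=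
    ⟨⟨p, hp, rfl⟩, by rintro _ ⟨q, hq, rfl⟩; exact hmax hq⟩
  unfold opt
  rwa [hg.csSup_eq]

/-- The number of past rounds in which the contract `p` was used. -/
noncomputable def playCount (p : Ω → ℝ) (h : ObsHistory Ω) : ℕ :=
  open Classical in (h.filter fun x => x.1 = p).length

/-- The average payoff observed when the contract `p` was used. The payoff `r ω - p ω ∈ [-1,1]` of
a round is rescaled to `[0,1]`, the payoff range of UCB1. -/
noncomputable def averagePayoff (G : PrincipalAgent Ω Θ A) (p : Ω → ℝ) (h : ObsHistory Ω) : ℝ :=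
  open Classical in
    ((h.filter fun x => x.1 = p).map fun x => (1 + (G.r x.2 - p x.2)) / 2).sum / playCount p h

/-- The UCB1 index of an arm that has been played: average payoff plus `√(2 ln n / n_p)`, where
`n` is the number of rounds played so far and `n_p` the number of times that `p` was played. -/
noncomputable def ucbIndex (G : PrincipalAgent Ω Θ A) (p : Ω → ℝ) (h : ObsHistory Ω) : ℝ :=
  G.averagePayoff p h + √(2 * Real.log h.length / playCount p h)

/-- `π` is UCB1 with set of arms `B`: as long as some arm has never been played, play such an arm;
afterwards, play an arm with largest index. Ties are broken arbitrarily. -/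
def IsUCB1 (G : PrincipalAgent Ω Θ A) (B : Set (Ω → ℝ)) (π : ContractPolicy Ω) : Prop :=
  ∀ h, π h ∈ B ∧
    ((∃ q ∈ B, playCount q h = 0) → playCount (π h) h = 0) ∧
    ((∀ q ∈ B, playCount q h ≠ 0) → ∀ q ∈ B, G.ucbIndex q h ≤ G.ucbIndex (π h) h)

/-- `π` is the regret minimizer with horizon `T`: UCB1 on the grid of step `T^(-1/(m+1))`, where
`m` is the number of outcomes. -/
def IsRegretMinimizer (G : PrincipalAgent Ω Θ A) (T : ℕ) (π : ContractPolicy Ω) : Prop :=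
  G.IsUCB1 (contractGrid Ω ((T : ℝ) ^ (-(1 / ((Fintype.card Ω : ℝ) + 1))))) π

/-- The observations of the principal when the realized pairs (type, outcome) are the entries of
the list, the most recent round first. -/
def observed (π : ContractPolicy Ω) : List (Θ × Ω) → ObsHistory Ω
  | [] => []
  | x :: l => (π (observed π l), x.2) :: observed π l

/-- The probability that the realized pairs (type, outcome) are the entries of the list, the most
recent round first: in each round the type `θ` is drawn from `lam`, independently of the past, and
the outcome is then drawn from the distribution induced by the action `resp θ p` of the agent,
where `p` is the contract chosen by `π` given the past observations. -/
def runProb (G : PrincipalAgent Ω Θ A) (resp : Θ → (Ω → ℝ) → A) (π : ContractPolicy Ω) :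
    List (Θ × Ω) → ℝ
  | [] => 1
  | x :: l => runProb G resp π l *
      (G.lam x.1 * G.F x.1 (resp x.1 (π (observed π l))) x.2)

/-- The expected value, over the interaction of `T` rounds, of the sum over the rounds of the
principal's expected utility from the contract used in the round. -/
def expectedTotalUtility (G : PrincipalAgent Ω Θ A) (resp : Θ → (Ω → ℝ) → A)
    (π : ContractPolicy Ω) (T : ℕ) : ℝ :=
  ∑ x : Fin T → Θ × Ω, G.runProb resp π (List.ofFn x) *
    ((observed π (List.ofFn x)).map fun y => G.expectedUtility resp y.1).sum

/-- The regret of `π` after `T` rounds with respect to an optimal non-robust contract in the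
hypercube: the benchmark uses the favorable exact best responses `a₀`, whereas the agent in the
interaction plays the `δ`-best responses `aδ`. -/
noncomputable def nonRobustRegret (G : PrincipalAgent Ω Θ A) (a₀ aδ : Θ → (Ω → ℝ) → A)
    (π : ContractPolicy Ω) (T : ℕ) : ℝ :=
  T * G.opt a₀ - G.expectedTotalUtility aδ π T

end PrincipalAgent

/-!
The contracts on the grid are the arms of a stochastic bandit: once the contract `p` is fixed, the
rescaled payoffs are independent, lie in `[0,1]` and have mean `(1 + U p) / 2`, where `U p` is the
principal's expected utility against worst-case `δ`-best responses. The regret splits into the loss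
from replacing an optimal contract by a grid point and the regret of UCB1 on the grid.

*Discretization and robustness.* If `p` is a contract and `a` a best response to it, move `p` by a
fraction `s` towards the reward vector and round down to the grid. The shift aligns the agent with
the principal: a `δ`-best response to the new contract is, up to `(δ + ε) / s`, as profitable under
`p` as `a`, and the shift costs at most the fraction `s` of the profit. With `s = √(δ + ε)` the loss
is at most `2√δ + 2√ε` (`exists_mem_contractGrid_expectedUtility_ge`).

*UCB1.* For each arm and each real `s`, the exponential of `s` times the accumulated deviation minus
`s² / 8` times the number of plays is a supermartingale by Hoeffding's lemma, however the arms are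
chosen (`runMean_exp_deviation_le_one`). Choosing `s` according to each possible number of plays
bounds the probability that some confidence interval fails after `n` rounds by `2 |B| / n`, with a
loose but sufficient union bound. When no interval fails, the gap of the arm played is at most twice
its confidence radius, which is of order `√(ln T)` times the increase of the potential `∑ₚ √Nₚ`;
by Cauchy-Schwarz the potential never exceeds `√(|B| T)` (`regret_le_of_isUCB1`).

The grid has at most `3^m T^(m/(m+1))` points, so that `√(|B| T)` and `T √ε` are both of order
`T^(1 - 1/(2(m+1)))`. For the sublinear statement, the regret is also nonnegative: exact best
responses are `δ`-best responses, so no contract in the cube does better against the latter than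
`opt` (`nonRobustRegret_nonneg`).
-/

/-! ### Hoeffding's lemma -/

open ProbabilityTheory MeasureTheory in
/-- Hoeffding's lemma for a finitely supported random variable with values in `[0,1]`. -/
theorem sum_mul_exp_le_of_mem_Icc {Y : Type*} [Fintype Y] (w X : Y → ℝ)
    (hw : ∀ y, 0 ≤ w y) (hw1 : ∑ y, w y = 1) (hX : ∀ y, X y ∈ Set.Icc (0 : ℝ) 1) (s : ℝ) :
    ∑ y, w y * Real.exp (s * (X y - ∑ z, w z * X z)) ≤ Real.exp (s ^ 2 / 8) := by
  classical
  let _ : MeasurableSpace Y := ⊤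
  have hP1 : ∑ y, ENNReal.ofReal (w y) = 1 := by
    rw [← ENNReal.ofReal_sum_of_nonneg fun y _ => hw y, hw1, ENNReal.ofReal_one]
  let P : PMF Y := PMF.ofFintype (fun y => ENNReal.ofReal (w y)) hP1
  have hint (f : Y → ℝ) : ∫ y, f y ∂P.toMeasure = ∑ y, w y * f y := by
    rw [PMF.integral_eq_sum]
    exact Finset.sum_congr rfl fun y _ => by
      rw [smul_eq_mul, PMF.ofFintype_apply, ENNReal.toReal_ofReal (hw y)]
  have h := (hasSubgaussianMGF_of_mem_Icc (μ := P.toMeasure) (X := X) (a := 0) (b := 1)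
    (measurable_from_top.aemeasurable) (Filter.Eventually.of_forall hX)).mgf_le s
  simp only [mgf, hint] at h
  refine h.trans (le_of_eq ?_)
  norm_num
  ring

namespace PrincipalAgent

/-! ### The contract grid and the discretization error -/

theorem contractGrid_subset_contractCube {Ω : Type*} {ε : ℝ} (hε : 0 ≤ ε) :
    contractGrid Ω ε ⊆ contractCube Ω := by
  intro p hp ω
  rcases hp ω with ⟨k, hk, h1⟩ | h1
  · exact ⟨by rw [hk]; positivity, h1⟩
  · exact ⟨by rw [h1]; norm_num, h1.le⟩

/-- Rounding every payment down to a multiple of the step stays on the grid. -/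
theorem exists_mem_contractGrid_le {Ω : Type*} {ε : ℝ} (hε : 0 < ε) {p : Ω → ℝ}
    (hp : p ∈ contractCube Ω) :
    ∃ q ∈ contractGrid Ω ε, ∀ ω, q ω ≤ p ω ∧ p ω - ε ≤ q ω := by
  have hle : ∀ ω, (⌊p ω / ε⌋₊ : ℝ) * ε ≤ p ω := fun ω => by
    have := Nat.floor_le (div_nonneg (hp ω).1 hε.le)
    rwa [le_div_iff₀ hε] at this
  refine ⟨fun ω => ⌊p ω / ε⌋₊ * ε,
    fun ω => Or.inl ⟨_, rfl, (hle ω).trans (hp ω).2⟩, fun ω => ⟨hle ω, ?_⟩⟩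
  have := (Nat.lt_floor_add_one (p ω / ε)).le
  rw [div_le_iff₀ hε] at this
  dsimp only
  linarith

variable {Ω Θ A : Type*} [Fintype Ω] [Fintype Θ]

/-- The grid of step `ε ≤ 1` has at most `(3/ε)^m` points. -/
theorem contractGrid_finite_and_card_le {ε : ℝ} (hε : 0 < ε) (hε1 : ε ≤ 1) :
    ∃ B : Finset (Ω → ℝ), (B : Set (Ω → ℝ)) = contractGrid Ω ε ∧
      (B.card : ℝ) ≤ (3 / ε) ^ Fintype.card Ω := by
  classical
  let S : Finset ℝ := insert 1 ((Finset.range (⌊1 / ε⌋₊ + 1)).image fun k : ℕ => (k : ℝ) * ε)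
  have hS : (S.card : ℝ) ≤ 3 / ε := by
    have h1 : S.card ≤ ⌊1 / ε⌋₊ + 1 + 1 :=
      (Finset.card_insert_le _ _).trans
        (Nat.add_le_add_right (Finset.card_image_le.trans (Finset.card_range _).le) 1)
    have h2 : (⌊1 / ε⌋₊ : ℝ) ≤ 1 / ε := Nat.floor_le (by positivity)
    have h3 : 1 ≤ 1 / ε := by rwa [le_div_iff₀ hε, one_mul]
    have h4 : (S.card : ℝ) ≤ ⌊1 / ε⌋₊ + 1 + 1 := by exact_mod_cast h1
    have h5 : 3 / ε = 3 * (1 / ε) := by ring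
    linarith
  have hsub : contractGrid Ω ε ⊆ (Fintype.piFinset fun _ : Ω => S : Finset (Ω → ℝ)) := by
    intro p hp
    simp only [Finset.mem_coe, Fintype.mem_piFinset]
    intro ω
    rcases hp ω with ⟨k, hk, h1⟩ | h1
    · refine Finset.mem_insert_of_mem (Finset.mem_image.2 ⟨k, ?_, hk.symm⟩)
      rw [Finset.mem_range, Nat.lt_succ_iff]
      apply Nat.le_floor
      rwa [le_div_iff₀ hε, ← hk]
    · rw [h1]; exact Finset.mem_insert_self _ _
  have hfin : (contractGrid Ω ε).Finite := (Finset.finite_toSet _).subset hsub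
  refine ⟨hfin.toFinset, hfin.coe_toFinset, ?_⟩
  have hcard : hfin.toFinset.card ≤ S.card ^ Fintype.card Ω := by
    refine (Finset.card_le_card fun x hx => hsub (hfin.mem_toFinset.1 hx)).trans ?_
    simp [Fintype.card_piFinset]
  calc (hfin.toFinset.card : ℝ) ≤ (S.card : ℝ) ^ Fintype.card Ω := by exact_mod_cast hcard
    _ ≤ _ := by gcongr

theorem principalUtility_mem_Icc (G : PrincipalAgent Ω Θ A) {p : Ω → ℝ} (hp : p ∈ contractCube Ω)
    (θ : Θ) (a : A) : G.principalUtility θ p a ∈ Set.Icc (-1 : ℝ) 1 := by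
  have h0 := (G.F_mem θ a).1
  have h1 := (G.F_mem θ a).2
  unfold principalUtility
  constructor
  · calc (-1 : ℝ) = ∑ ω, G.F θ a ω * (-1) := by rw [← Finset.sum_mul, h1, one_mul]
      _ ≤ _ := Finset.sum_le_sum fun ω _ => mul_le_mul_of_nonneg_left
        (by linarith [(hp ω).2, (G.r_mem ω).1]) (h0 ω)
  · calc ∑ ω, G.F θ a ω * (G.r ω - p ω) ≤ ∑ ω, G.F θ a ω * 1 :=
          Finset.sum_le_sum fun ω _ => mul_le_mul_of_nonneg_left
            (by linarith [(hp ω).1, (G.r_mem ω).2]) (h0 ω)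
      _ = 1 := by rw [← Finset.sum_mul, h1, one_mul]

theorem sum_lam_mul_le (G : PrincipalAgent Ω Θ A) {f g : Θ → ℝ} {c : ℝ}
    (h : ∀ θ, f θ ≤ g θ + c) : ∑ θ, G.lam θ * f θ ≤ ∑ θ, G.lam θ * g θ + c := by
  calc ∑ θ, G.lam θ * f θ ≤ ∑ θ, G.lam θ * (g θ + c) :=
        Finset.sum_le_sum fun θ _ => mul_le_mul_of_nonneg_left (h θ) (G.lam_mem.1 θ)
    _ = _ := by simp only [mul_add, Finset.sum_add_distrib, ← Finset.sum_mul, G.lam_mem.2, one_mul]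

theorem expectedUtility_mem_Icc (G : PrincipalAgent Ω Θ A) (resp : Θ → (Ω → ℝ) → A) {p : Ω → ℝ}
    (hp : p ∈ contractCube Ω) : G.expectedUtility resp p ∈ Set.Icc (-1 : ℝ) 1 := by
  have hu := fun θ => G.principalUtility_mem_Icc hp θ (resp θ p)
  constructor
  · have := G.sum_lam_mul_le (f := fun _ => 0) (c := 1)
      (g := fun θ => G.principalUtility θ p (resp θ p)) fun θ => by linarith [(hu θ).1]
    simp only [mul_zero, Finset.sum_const_zero] at this
    unfold expectedUtility
    linarith
  · have := G.sum_lam_mul_le (g := fun _ => 0) (c := 1)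
      (f := fun θ => G.principalUtility θ p (resp θ p)) fun θ => by linarith [(hu θ).2]
    simpa [expectedUtility] using this

/-- Let `q` be a contract that is at most `ε` below `p + s (r - p)` at every outcome. Paying `q`
gives up a fraction `s` of the principal's profit, but any `δ`-best response to `q` is, for the
principal, at most `(δ + ε) / s` worse than the exact best response to `p`: comparing the two
incentive constraints leaves `s F_b (r - p) ≥ s F_a (r - p) - δ - ε`. -/
theorem principalUtility_le_of_shifted (G : PrincipalAgent Ω Θ A) {p q : Ω → ℝ}
    (hp : p ∈ contractCube Ω) {δ ε s : ℝ} (hδ : 0 ≤ δ) (hε : 0 ≤ ε) (hs : 0 < s) (hs1 : s ≤ 1)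
    (hq : ∀ ω, q ω ≤ p ω + s * (G.r ω - p ω) ∧ p ω + s * (G.r ω - p ω) - ε ≤ q ω)
    {θ : Θ} {a b : A} (ha : a ∈ G.bestResponses θ p) (hb : b ∈ G.approxBestResponses δ θ q) :
    G.principalUtility θ p a ≤ G.principalUtility θ q b + (s + (δ + ε) / s) := by
  have h1 := ha b
  have h2 := hb a
  have hlin : ∀ (x : A) (u v : Ω → ℝ), (∀ ω, u ω ≤ v ω) →
      ∑ ω, G.F θ x ω * u ω ≤ ∑ ω, G.F θ x ω * v ω := fun x u v h =>
    Finset.sum_le_sum fun ω _ => mul_le_mul_of_nonneg_left (h ω) ((G.F_mem θ x).1 ω)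
  have hb1 := hlin b _ _ fun ω => (hq ω).1
  have ha1 := hlin a _ _ fun ω => (hq ω).2
  have hup := (G.principalUtility_mem_Icc hp θ a).2
  have hF := (G.F_mem θ a).2
  simp only [agentUtility, principalUtility, mul_sub, mul_add, Finset.sum_sub_distrib,
    Finset.sum_add_distrib, mul_left_comm _ s, ← Finset.mul_sum, ← Finset.sum_mul, hF, one_mul]
    at h1 h2 hb1 ha1 hup ⊢
  set ap := ∑ ω, G.F θ a ω * p ω
  set aq := ∑ ω, G.F θ a ω * q ω
  set ar := ∑ ω, G.F θ a ω * G.r ω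
  set bp := ∑ ω, G.F θ b ω * p ω
  set bq := ∑ ω, G.F θ b ω * q ω
  set br := ∑ ω, G.F θ b ω * G.r ω
  set e := (δ + ε) / s with he
  have hes : s * e = δ + ε := by rw [he]; field_simp
  have he0 : 0 ≤ e := by positivity
  have hk : s * (ar - ap) ≤ s * (br - bp + e) := by linarith
  have hk' := le_of_mul_le_mul_left hk hs
  have h3 : (1 - s) * (ar - ap) ≤ (1 - s) * (br - bp + e) :=
    mul_le_mul_of_nonneg_left hk' (by linarith)
  have h4 : s * (ar - ap) ≤ s * 1 := mul_le_mul_of_nonneg_left hup hs.le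
  have h5 : 0 ≤ s * e := by positivity
  linarith

/-- Some grid contract, facing worst-case `δ`-best responses, loses at most `2√(δ + ε)` with respect
to a contract facing favorable exact best responses: shift by the fraction `s = √(δ + ε)`, which
balances the two losses `s` and `(δ + ε) / s`, and round down. -/
theorem exists_mem_contractGrid_expectedUtility_ge (G : PrincipalAgent Ω Θ A) {δ ε : ℝ}
    (hδ : 0 < δ) (hε : 0 < ε) {a₀ aδ : Θ → (Ω → ℝ) → A} (h₀ : G.IsFavorableResponse a₀)
    (h₁ : G.IsRobustResponse δ aδ) {p : Ω → ℝ} (hp : p ∈ contractCube Ω) :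
    ∃ q ∈ contractGrid Ω ε,
      G.expectedUtility a₀ p ≤ G.expectedUtility aδ q + 2 * √(δ + ε) := by
  set s := √(δ + ε)
  have hs0 : 0 < s := Real.sqrt_pos.2 (by linarith)
  have hss : s * s = δ + ε := Real.mul_self_sqrt (by linarith)
  by_cases hs : s ≤ 1
  · have hcube : (fun ω => p ω + s * (G.r ω - p ω)) ∈ contractCube Ω := fun ω => by
      have h1 := mul_nonneg (sub_nonneg.2 hs) (hp ω).1
      have h2 := mul_nonneg hs0.le (G.r_mem ω).1
      have h3 := mul_nonneg (sub_nonneg.2 hs) (sub_nonneg.2 (hp ω).2)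
      have h4 := mul_nonneg hs0.le (sub_nonneg.2 (G.r_mem ω).2)
      constructor <;> dsimp only <;> linarith
    obtain ⟨q, hq, hqp⟩ := exists_mem_contractGrid_le hε hcube
    refine ⟨q, hq, G.sum_lam_mul_le fun θ => ?_⟩
    have hq0 := contractGrid_subset_contractCube hε.le hq
    have := G.principalUtility_le_of_shifted hp hδ.le hε.le hs0 hs hqp
      (h₀ θ p fun ω => (hp ω).1).1 (h₁ θ q fun ω => (hq0 ω).1).1
    rwa [← hss, mul_div_assoc, div_self hs0.ne', mul_one, ← two_mul] at this
  -- Utilities lie in `[-1, 1]`, so any grid point will do when `s > 1`.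
  · obtain ⟨q, hq, -⟩ := exists_mem_contractGrid_le hε hp
    have h1 := (G.expectedUtility_mem_Icc aδ (contractGrid_subset_contractCube hε.le hq)).1
    have h2 := (G.expectedUtility_mem_Icc a₀ hp).2
    exact ⟨q, hq, by linarith⟩

/-- Worst-case `δ`-best responses are no better for the principal than favorable best responses,
because exact best responses are `δ`-best responses. -/
theorem expectedUtility_robust_le_opt (G : PrincipalAgent Ω Θ A) [Finite A] {δ : ℝ} (hδ : 0 < δ)
    {a₀ aδ : Θ → (Ω → ℝ) → A} (h₀ : G.IsFavorableResponse a₀) (h₁ : G.IsRobustResponse δ aδ)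
    {p : Ω → ℝ} (hp : p ∈ contractCube Ω) : G.expectedUtility aδ p ≤ G.opt a₀ := by
  refine le_trans ?_ ((G.opt_isGreatest a₀ h₀).2 ⟨p, hp, rfl⟩)
  refine Finset.sum_le_sum fun θ _ => mul_le_mul_of_nonneg_left ?_ (G.lam_mem.1 θ)
  exact (h₁ θ p fun ω => (hp ω).1).2 _ fun b =>
    by linarith [(h₀ θ p fun ω => (hp ω).1).1 b]

/-! ### Expectations over the interaction -/

/-- The probability of the pair (type, outcome) in a round in which the contract is `p`. -/
def stepProb (G : PrincipalAgent Ω Θ A) (resp : Θ → (Ω → ℝ) → A) (p : Ω → ℝ) (y : Θ × Ω) : ℝ :=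
  G.lam y.1 * G.F y.1 (resp y.1 p) y.2

/-- The expected value of `f` at the list of the pairs (type, outcome) realized in `n` rounds. -/
def runMean (G : PrincipalAgent Ω Θ A) (resp : Θ → (Ω → ℝ) → A) (π : ContractPolicy Ω) (n : ℕ)
    (f : List (Θ × Ω) → ℝ) : ℝ :=
  ∑ x : Fin n → Θ × Ω, G.runProb resp π (List.ofFn x) * f (List.ofFn x)

/-- The payoff of a round, rescaled to `[0,1]`. -/
noncomputable def scaledPayoff (G : PrincipalAgent Ω Θ A) (p : Ω → ℝ) (ω : Ω) : ℝ :=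
  (1 + (G.r ω - p ω)) / 2

theorem scaledPayoff_mem_Icc (G : PrincipalAgent Ω Θ A) {p : Ω → ℝ} (hp : p ∈ contractCube Ω)
    (ω : Ω) : G.scaledPayoff p ω ∈ Set.Icc (0 : ℝ) 1 := by
  have h1 := hp ω
  have h2 := G.r_mem ω
  unfold scaledPayoff
  constructor <;> linarith [h1.1, h1.2, h2.1, h2.2]

section StepProb

variable (G : PrincipalAgent Ω Θ A) (resp : Θ → (Ω → ℝ) → A) (p : Ω → ℝ)

theorem stepProb_nonneg (y : Θ × Ω) : 0 ≤ G.stepProb resp p y :=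
  mul_nonneg (G.lam_mem.1 _) ((G.F_mem _ _).1 _)

theorem sum_stepProb_mul (f : Ω → ℝ) : ∑ y, G.stepProb resp p y * f y.2 =
    ∑ θ, G.lam θ * ∑ ω, G.F θ (resp θ p) ω * f ω := by
  rw [Fintype.sum_prod_type]
  simp only [stepProb, Finset.mul_sum, mul_assoc]

theorem sum_stepProb : ∑ y, G.stepProb resp p y = 1 := by
  have := G.sum_stepProb_mul resp p fun _ => 1
  simpa [(G.F_mem _ _).2, G.lam_mem.2] using this

theorem sum_stepProb_mul_scaledPayoff : ∑ y, G.stepProb resp p y * G.scaledPayoff p y.2 =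
    (1 + G.expectedUtility resp p) / 2 := by
  have h1 := G.sum_stepProb resp p
  have h2 := G.sum_stepProb_mul resp p fun ω => G.r ω - p ω
  have h3 : ∀ y : Θ × Ω, G.stepProb resp p y * G.scaledPayoff p y.2 =
      (G.stepProb resp p y + G.stepProb resp p y * (G.r y.2 - p y.2)) / 2 := fun y => by
    unfold scaledPayoff; ring
  simp only [h3, ← Finset.sum_div, Finset.sum_add_distrib, h1, h2, expectedUtility,
    principalUtility]

end StepProb

theorem length_observed {Ω Θ : Type*} (π : ContractPolicy Ω) :
    ∀ l : List (Θ × Ω), (observed π l).length = l.length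
  | [] => rfl
  | _ :: l => congrArg (· + 1) (length_observed π l)

section RunMean

variable (G : PrincipalAgent Ω Θ A) (resp : Θ → (Ω → ℝ) → A) (π : ContractPolicy Ω)

theorem runProb_nonneg : ∀ l : List (Θ × Ω), 0 ≤ G.runProb resp π l
  | [] => zero_le_one
  | _ :: l => mul_nonneg (runProb_nonneg l) (G.stepProb_nonneg resp _ _)

theorem runMean_zero (f : List (Θ × Ω) → ℝ) : G.runMean resp π 0 f = f [] := by
  simp [runMean, runProb]

theorem runMean_succ (n : ℕ) (f : List (Θ × Ω) → ℝ) :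
    G.runMean resp π (n + 1) f = G.runMean resp π n fun l =>
      ∑ y, G.stepProb resp (π (observed π l)) y * f (y :: l) := by
  unfold runMean
  rw [← (Fin.consEquiv fun _ : Fin (n + 1) => Θ × Ω).sum_comp, Fintype.sum_prod_type,
    Finset.sum_comm]
  refine Finset.sum_congr rfl fun x _ => ?_
  rw [Finset.mul_sum]
  refine Finset.sum_congr rfl fun y _ => ?_
  simp only [Fin.consEquiv, Equiv.coe_fn_mk, List.ofFn_cons, runProb, stepProb]
  ring

theorem runMean_mono {n : ℕ} {f g : List (Θ × Ω) → ℝ} (h : ∀ l, l.length = n → f l ≤ g l) :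
    G.runMean resp π n f ≤ G.runMean resp π n g :=
  Finset.sum_le_sum fun _ _ => mul_le_mul_of_nonneg_left (h _ (List.length_ofFn))
    (G.runProb_nonneg resp π _)

theorem runMean_add (n : ℕ) (f g : List (Θ × Ω) → ℝ) :
    G.runMean resp π n (fun l => f l + g l) = G.runMean resp π n f + G.runMean resp π n g := by
  simp only [runMean, mul_add, Finset.sum_add_distrib]

theorem runMean_const_mul (n : ℕ) (c : ℝ) (f : List (Θ × Ω) → ℝ) :
    G.runMean resp π n (fun l => c * f l) = c * G.runMean resp π n f := by
  simp only [runMean, Finset.mul_sum, mul_left_comm c]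

theorem runMean_sum {ι : Type*} (n : ℕ) (s : Finset ι) (f : ι → List (Θ × Ω) → ℝ) :
    G.runMean resp π n (fun l => ∑ i ∈ s, f i l) = ∑ i ∈ s, G.runMean resp π n (f i) := by
  simp only [runMean, Finset.mul_sum]
  rw [Finset.sum_comm]

theorem runMean_const (c : ℝ) : ∀ n : ℕ, G.runMean resp π n (fun _ => c) = c
  | 0 => G.runMean_zero resp π _
  | n + 1 => by
    rw [runMean_succ]
    simp only [← Finset.sum_mul, sum_stepProb, one_mul]
    exact runMean_const c n

end RunMean

/-! ### Concentration of the observed payoffs -/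

/-- The sum of the deviations of the rescaled payoffs of the contract `p` from their mean. -/
noncomputable def deviation (G : PrincipalAgent Ω Θ A) (resp : Θ → (Ω → ℝ) → A) (p : Ω → ℝ)
    (h : ObsHistory Ω) : ℝ :=
  playCount p h * (G.averagePayoff p h - (1 + G.expectedUtility resp p) / 2)

theorem playCount_cons_self (p : Ω → ℝ) (ω : Ω) (h : ObsHistory Ω) :
    playCount p ((p, ω) :: h) = playCount p h + 1 := by
  simp [playCount]

theorem playCount_cons_of_ne {p q : Ω → ℝ} (hq : q ≠ p) (ω : Ω) (h : ObsHistory Ω) :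
    playCount p ((q, ω) :: h) = playCount p h := by
  simp [playCount, hq]

theorem playCount_le_length (p : Ω → ℝ) (h : ObsHistory Ω) : playCount p h ≤ h.length :=
  List.length_filter_le _ _

theorem deviation_nil (G : PrincipalAgent Ω Θ A) (resp : Θ → (Ω → ℝ) → A) (p : Ω → ℝ) :
    G.deviation resp p [] = 0 := by
  simp [deviation, playCount]

theorem deviation_cons_of_ne (G : PrincipalAgent Ω Θ A) (resp : Θ → (Ω → ℝ) → A) {p q : Ω → ℝ}
    (hq : q ≠ p) (ω : Ω) (h : ObsHistory Ω) :
    G.deviation resp p ((q, ω) :: h) = G.deviation resp p h := by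
  simp [deviation, playCount, averagePayoff, hq]

open Classical in
theorem playCount_mul_averagePayoff (G : PrincipalAgent Ω Θ A) (p : Ω → ℝ) (h : ObsHistory Ω) :
    playCount p h * G.averagePayoff p h =
      ((h.filter fun x => x.1 = p).map fun x => G.scaledPayoff p x.2).sum := by
  unfold averagePayoff
  by_cases h0 : (playCount p h : ℝ) = 0
  · have : (h.filter fun x => x.1 = p) = [] :=
      List.eq_nil_of_length_eq_zero (by exact_mod_cast h0)
    rw [h0, this]; simp
  · rw [mul_div_cancel₀ _ h0]; rfl

theorem deviation_cons_self (G : PrincipalAgent Ω Θ A) (resp : Θ → (Ω → ℝ) → A) (p : Ω → ℝ)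
    (ω : Ω) (h : ObsHistory Ω) :
    G.deviation resp p ((p, ω) :: h) = G.deviation resp p h +
      (G.scaledPayoff p ω - (1 + G.expectedUtility resp p) / 2) := by
  classical
  simp only [deviation, mul_sub, playCount_mul_averagePayoff]
  rw [playCount_cons_self]
  simp
  ring

/-- The exponential supermartingale of an arm: by Hoeffding's lemma, its mean never exceeds `1`,
whatever the rule that chooses the contracts. -/
theorem runMean_exp_deviation_le_one (G : PrincipalAgent Ω Θ A) (resp : Θ → (Ω → ℝ) → A)
    (π : ContractPolicy Ω) {p : Ω → ℝ} (hp : p ∈ contractCube Ω) (s : ℝ) : ∀ n : ℕ,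
    G.runMean resp π n (fun l => Real.exp (s * G.deviation resp p (observed π l) -
      s ^ 2 / 8 * playCount p (observed π l))) ≤ 1
  | 0 => by rw [runMean_zero]; simp [observed, deviation_nil, playCount]
  | n + 1 => by
    rw [runMean_succ]
    refine le_trans (G.runMean_mono resp π fun l _ => ?_)
      (runMean_exp_deviation_le_one G resp π hp s n)
    by_cases hq : π (observed π l) = p
    · have hH := sum_mul_exp_le_of_mem_Icc (G.stepProb resp p)
        (fun y => G.scaledPayoff p y.2) (G.stepProb_nonneg resp p) (G.sum_stepProb resp p)
        (fun y => G.scaledPayoff_mem_Icc hp y.2) s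
      rw [sum_stepProb_mul_scaledPayoff] at hH
      set D := G.deviation resp p (observed π l) with hD
      set N : ℝ := (playCount p (observed π l) : ℝ) with hN
      have hstep : ∀ y : Θ × Ω, G.stepProb resp p y *
          Real.exp (s * G.deviation resp p (observed π (y :: l)) -
            s ^ 2 / 8 * playCount p (observed π (y :: l))) =
          Real.exp (s * D - s ^ 2 / 8 * N) * Real.exp (-(s ^ 2 / 8)) * (G.stepProb resp p y *
            Real.exp (s * (G.scaledPayoff p y.2 - (1 + G.expectedUtility resp p) / 2))) := by
        intro y
        rw [observed, hq, deviation_cons_self, playCount_cons_self, mul_left_comm _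
          (G.stepProb resp p y), ← Real.exp_add, ← Real.exp_add, ← hD]
        congr 2
        push_cast
        rw [← hN]
        ring
      rw [hq]
      simp only [hstep]
      rw [← Finset.mul_sum, mul_assoc]
      refine mul_le_of_le_one_right (Real.exp_nonneg _) ?_
      calc _ ≤ Real.exp (-(s ^ 2 / 8)) * Real.exp (s ^ 2 / 8) :=
            mul_le_mul_of_nonneg_left hH (Real.exp_nonneg _)
        _ = 1 := by rw [← Real.exp_add]; simp
    · have hstep : ∀ y : Θ × Ω, Real.exp (s * G.deviation resp p (observed π (y :: l)) -
            s ^ 2 / 8 * playCount p (observed π (y :: l))) =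
          Real.exp (s * G.deviation resp p (observed π l) -
            s ^ 2 / 8 * playCount p (observed π l)) := fun y => by
        rw [observed, deviation_cons_of_ne _ _ hq, playCount_cons_of_ne hq]
      simp only [hstep, ← Finset.sum_mul, sum_stepProb, one_mul, le_refl]

/-- A bound for the indicator of the event that, after `n` rounds, the average payoff of some arm
of `B` is off its mean by more than the confidence radius `√(2 ln n / k)`, where `k` is the number
of plays of the arm. It sums, over the arms and over the possible values of `k`, the exponential
supermartingales of the arm with parameters `±4 √(2 ln n / k)`, normalized by `n⁴`. -/
noncomputable def confidenceFailure (G : PrincipalAgent Ω Θ A) (resp : Θ → (Ω → ℝ) → A)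
    (B : Finset (Ω → ℝ)) (n : ℕ) (h : ObsHistory Ω) : ℝ :=
  ∑ p ∈ B, ∑ k ∈ Finset.Icc 1 n, ((n : ℝ) ^ 4)⁻¹ *
    (Real.exp (4 * √(2 * Real.log n / k) * G.deviation resp p h -
        (4 * √(2 * Real.log n / k)) ^ 2 / 8 * playCount p h) +
      Real.exp (-(4 * √(2 * Real.log n / k)) * G.deviation resp p h -
        (-(4 * √(2 * Real.log n / k))) ^ 2 / 8 * playCount p h))

theorem confidenceFailure_nonneg (G : PrincipalAgent Ω Θ A) (resp : Θ → (Ω → ℝ) → A)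
    (B : Finset (Ω → ℝ)) (n : ℕ) (h : ObsHistory Ω) : 0 ≤ G.confidenceFailure resp B n h :=
  Finset.sum_nonneg fun _ _ => Finset.sum_nonneg fun _ _ => by positivity

theorem runMean_confidenceFailure_le (G : PrincipalAgent Ω Θ A) (resp : Θ → (Ω → ℝ) → A)
    (π : ContractPolicy Ω) {B : Finset (Ω → ℝ)} (hB : (B : Set (Ω → ℝ)) ⊆ contractCube Ω) (n : ℕ) :
    G.runMean resp π n (fun l => G.confidenceFailure resp B n (observed π l)) ≤
      2 * B.card * (n : ℝ)⁻¹ := by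
  unfold confidenceFailure
  have hterm : ∀ p ∈ B, ∀ k ∈ Finset.Icc 1 n, G.runMean resp π n (fun l => ((n : ℝ) ^ 4)⁻¹ *
      (Real.exp (4 * √(2 * Real.log n / k) * G.deviation resp p (observed π l) -
        (4 * √(2 * Real.log n / k)) ^ 2 / 8 * playCount p (observed π l)) +
      Real.exp (-(4 * √(2 * Real.log n / k)) * G.deviation resp p (observed π l) -
        (-(4 * √(2 * Real.log n / k))) ^ 2 / 8 * playCount p (observed π l)))) ≤
      ((n : ℝ) ^ 4)⁻¹ * 2 := by
    intro p hp k _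
    rw [runMean_const_mul, runMean_add]
    have h1 := G.runMean_exp_deviation_le_one resp π (hB hp) (4 * √(2 * Real.log n / k)) n
    have h2 := G.runMean_exp_deviation_le_one resp π (hB hp) (-(4 * √(2 * Real.log n / k))) n
    exact mul_le_mul_of_nonneg_left (by linarith) (by positivity)
  simp only [runMean_sum]
  refine (Finset.sum_le_sum fun p hp => Finset.sum_le_sum (hterm p hp)).trans ?_
  simp only [Finset.sum_const, Nat.card_Icc, nsmul_eq_mul, Nat.add_sub_cancel]
  rcases Nat.eq_zero_or_pos n with rfl | hn
  · simp
  · have hn1 : (1 : ℝ) ≤ n := by exact_mod_cast hn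
    have h3 : (n : ℝ) * (((n : ℝ) ^ 4)⁻¹ * 2) ≤ 2 * (n : ℝ)⁻¹ := by
      have h4 : (n : ℝ) * (((n : ℝ) ^ 4)⁻¹ * 2) = 2 * ((n : ℝ) ^ 3)⁻¹ := by field_simp
      rw [h4]
      have h5 : (n : ℝ) ≤ (n : ℝ) ^ 3 := le_self_pow₀ hn1 (by norm_num)
      gcongr
    calc _ ≤ (B.card : ℝ) * (2 * (n : ℝ)⁻¹) := by gcongr
      _ = _ := by ring

/-- The failure of a confidence interval makes one of the summands at least `1`, namely the one
for the actual number of plays and the sign of the deviation. -/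
theorem one_le_confidenceFailure (G : PrincipalAgent Ω Θ A) (resp : Θ → (Ω → ℝ) → A)
    {B : Finset (Ω → ℝ)} {p : Ω → ℝ} (hp : p ∈ B) {h : ObsHistory Ω} (hN : playCount p h ≠ 0)
    (hdev : √(2 * Real.log h.length / playCount p h) <
      |G.averagePayoff p h - (1 + G.expectedUtility resp p) / 2|) :
    1 ≤ G.confidenceFailure resp B h.length h := by
  have hlen := playCount_le_length p h
  have hN1 : 1 ≤ playCount p h := Nat.one_le_iff_ne_zero.2 hN
  have hn : (0 : ℝ) < h.length := by exact_mod_cast hN1.trans hlen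
  have hn1 : (1 : ℝ) ≤ h.length := by exact_mod_cast hN1.trans hlen
  have hNr : (0 : ℝ) < playCount p h := by exact_mod_cast hN1
  unfold confidenceFailure
  refine le_trans ?_ (Finset.single_le_sum (fun _ _ => Finset.sum_nonneg fun _ _ => by positivity)
    hp)
  refine le_trans ?_ (Finset.single_le_sum (fun _ _ => by positivity)
    (Finset.mem_Icc.2 ⟨hN1, hlen⟩))
  set c := √(2 * Real.log h.length / playCount p h)
  have hc0 : 0 ≤ c := Real.sqrt_nonneg _
  have hcc : c ^ 2 * playCount p h = 2 * Real.log h.length := by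
    rw [Real.sq_sqrt (div_nonneg (mul_nonneg two_pos.le (Real.log_nonneg hn1)) hNr.le)]
    field_simp
  have hpow : (h.length : ℝ) ^ 4 = Real.exp (4 * Real.log h.length) := by
    rw [mul_comm, Real.exp_mul, Real.exp_log hn]
    norm_cast
  rw [inv_mul_eq_div, le_div_iff₀ (by positivity), one_mul, hpow]
  -- The exponent `4 c D - 2 c² k` is at least `2 c² k = 4 ln n` once `|D| ≥ c k`.
  rcases lt_abs.1 hdev with h1 | h1
  · refine le_add_of_le_of_nonneg (Real.exp_le_exp.2 ?_) (Real.exp_nonneg _)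
    have h2 := mul_le_mul_of_nonneg_left h1.le (mul_nonneg hc0 hNr.le)
    unfold deviation
    nlinarith [h2, hcc]
  · refine le_add_of_nonneg_of_le (Real.exp_nonneg _) (Real.exp_le_exp.2 ?_)
    have h2 := mul_le_mul_of_nonneg_left h1.le (mul_nonneg hc0 hNr.le)
    unfold deviation
    nlinarith [h2, hcc]

/-! ### The regret of UCB1 -/

/-- The potential that pays for the confidence radii: playing for the `k`-th time an arm increases
it by `√k - √(k-1)`, which is of order `1/√k`. -/
noncomputable def playPotential (B : Finset (Ω → ℝ)) (h : ObsHistory Ω) : ℝ :=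
  ∑ p ∈ B, √(playCount p h)

theorem playPotential_cons {B : Finset (Ω → ℝ)} {p : Ω → ℝ} (hp : p ∈ B) (ω : Ω)
    (h : ObsHistory Ω) : playPotential B ((p, ω) :: h) =
      playPotential B h + (√(playCount p h + 1) - √(playCount p h)) := by
  rw [← sub_eq_iff_eq_add']
  unfold playPotential
  rw [← Finset.sum_sub_distrib, Finset.sum_eq_single_of_mem p hp]
  · rw [playCount_cons_self]; push_cast; rfl
  · intro q _ hq
    rw [playCount_cons_of_ne hq.symm, sub_self]

theorem sum_playCount_le_length (B : Finset (Ω → ℝ)) : ∀ h : ObsHistory Ω,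
    ∑ p ∈ B, playCount p h ≤ h.length
  | [] => by simp [playCount]
  | (q, ω) :: h => by
    classical
    have hstep : ∀ p ∈ B, playCount p ((q, ω) :: h) = playCount p h + if q = p then 1 else 0 := by
      intro p _
      split_ifs with hq
      · rw [hq, playCount_cons_self]
      · rw [playCount_cons_of_ne hq, add_zero]
    rw [Finset.sum_congr rfl hstep, Finset.sum_add_distrib, Finset.sum_ite_eq, List.length_cons]
    refine Nat.add_le_add (sum_playCount_le_length B h) ?_
    split_ifs <;> simp

theorem playPotential_le (B : Finset (Ω → ℝ)) (h : ObsHistory Ω) :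
    playPotential B h ≤ √(B.card * h.length) := by
  refine Real.le_sqrt_of_sq_le ((sq_sum_le_card_mul_sum_sq).trans ?_)
  have h1 : ∑ p ∈ B, √(playCount p h : ℝ) ^ 2 = ((∑ p ∈ B, playCount p h : ℕ) : ℝ) := by
    push_cast
    exact Finset.sum_congr rfl fun p _ => Real.sq_sqrt (Nat.cast_nonneg _)
  rw [h1]
  have := sum_playCount_le_length B h
  gcongr

/-- The increment of the square root at `x ≥ 1` dominates `1 / (3 √x)`. -/
theorem one_le_three_mul_sqrt_mul {x : ℝ} (hx : 1 ≤ x) : 1 ≤ 3 * √x * (√(x + 1) - √x) := by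
  have ha : √x ^ 2 = x := Real.sq_sqrt (by linarith)
  have hb : √(x + 1) ^ 2 = x + 1 := Real.sq_sqrt (by linarith)
  have hab : √x ≤ √(x + 1) := Real.sqrt_le_sqrt (by linarith)
  have hba : √(x + 1) ≤ 2 * √x := by
    refine Real.sqrt_le_iff.2 ⟨by positivity, ?_⟩
    rw [mul_pow, ha]
    linarith
  calc 1 = (√(x + 1) + √x) * (√(x + 1) - √x) := by linear_combination ha - hb
    _ ≤ _ := mul_le_mul_of_nonneg_right (by linarith) (sub_nonneg.2 hab)

/-- The loss of UCB1 in one round, in rescaled units, is paid for by the increase of the potential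
unless some confidence interval fails. -/
theorem gap_le_of_isUCB1 (G : PrincipalAgent Ω Θ A) (resp : Θ → (Ω → ℝ) → A)
    {π : ContractPolicy Ω} {B : Finset (Ω → ℝ)} (hB : (B : Set (Ω → ℝ)) ⊆ contractCube Ω)
    (hπ : G.IsUCB1 B π) {q : Ω → ℝ} (hq : q ∈ B) {T : ℕ} {h : ObsHistory Ω} (hT : h.length ≤ T)
    (ω : Ω) :
    (G.expectedUtility resp q - G.expectedUtility resp (π h)) / 2 ≤
      (1 + 6 * √(2 * Real.log T)) *
        (playPotential B ((π h, ω) :: h) - playPotential B h) +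
      G.confidenceFailure resp B h.length h := by
  obtain ⟨hmem, hexp, hmax⟩ := hπ h
  have hmem' : π h ∈ B := hmem
  rw [playPotential_cons hmem', add_sub_cancel_left]
  have hUq := (G.expectedUtility_mem_Icc resp (hB hq)).2
  have hUp := (G.expectedUtility_mem_Icc resp (hB hmem)).1
  have hF := G.confidenceFailure_nonneg resp B h.length h
  have hmono : 0 ≤ √((playCount (π h) h : ℝ) + 1) - √(playCount (π h) h) :=
    sub_nonneg.2 (Real.sqrt_le_sqrt (by linarith))
  by_cases h0 : playCount (π h) h = 0
  -- The first play of an arm raises the potential by `1`, which covers any rescaled gap.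
  · rw [h0]
    have := Real.sqrt_nonneg (2 * Real.log T)
    simp only [Nat.cast_zero, zero_add, Real.sqrt_one, Real.sqrt_zero]
    linarith
  have hall : ∀ p ∈ (B : Set (Ω → ℝ)), playCount p h ≠ 0 := fun p hp hp0 =>
    h0 (hexp ⟨p, hp, hp0⟩)
  by_cases hbad : 1 ≤ G.confidenceFailure resp B h.length h
  · have := mul_nonneg (by positivity : 0 ≤ 1 + 6 * √(2 * Real.log T)) hmono
    linarith
  have hgood : ∀ p ∈ B, |G.averagePayoff p h - (1 + G.expectedUtility resp p) / 2| ≤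
      √(2 * Real.log h.length / playCount p h) := fun p hp => by
    by_contra hlt
    exact hbad (G.one_le_confidenceFailure resp hp (hall p hp) (not_le.1 hlt))
  have hidx := hmax hall q hq
  unfold ucbIndex at hidx
  have h1 := (abs_le.1 (hgood q hq)).1
  have h2 := (abs_le.1 (hgood _ hmem')).2
  set N : ℝ := (playCount (π h) h : ℝ) with hN
  have hN1 : 1 ≤ N := by rw [hN]; exact_mod_cast Nat.one_le_iff_ne_zero.2 h0
  have hn : (1 : ℝ) ≤ h.length := by
    exact_mod_cast (Nat.one_le_iff_ne_zero.2 h0).trans (playCount_le_length _ h)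
  have hlog : √(2 * Real.log h.length) ≤ √(2 * Real.log T) := by gcongr
  have hradius : √(2 * Real.log h.length / N) ≤ √(2 * Real.log T) * (3 * (√(N + 1) - √N)) := by
    have hsN : 0 < √N := Real.sqrt_pos.2 (by linarith)
    rw [Real.sqrt_div' _ (by linarith), div_le_iff₀ hsN]
    calc √(2 * Real.log h.length) ≤ √(2 * Real.log T) * 1 := by rwa [mul_one]
      _ ≤ √(2 * Real.log T) * (3 * √N * (√(N + 1) - √N)) := by
        gcongr
        exact one_le_three_mul_sqrt_mul hN1
      _ = _ := by ring
  linarith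

/-- The regret of UCB1 with respect to an arbitrary arm; the bound does not depend on the gaps
between the arms. -/
theorem regret_le_of_isUCB1 (G : PrincipalAgent Ω Θ A) (resp : Θ → (Ω → ℝ) → A)
    {π : ContractPolicy Ω} {B : Finset (Ω → ℝ)} (hB : (B : Set (Ω → ℝ)) ⊆ contractCube Ω)
    (hπ : G.IsUCB1 B π) {q : Ω → ℝ} (hq : q ∈ B) (T : ℕ) :
    T * G.expectedUtility resp q - G.expectedTotalUtility resp π T ≤
      2 * ((1 + 6 * √(2 * Real.log T)) * √(B.card * T) + 2 * B.card * (1 + Real.log T)) := by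
  set w := 1 + 6 * √(2 * Real.log T)
  have hw : 0 ≤ w := by positivity
  let U := fun l : List (Θ × Ω) => ((observed π l).map fun y => G.expectedUtility resp y.1).sum
  let loss := fun l : List (Θ × Ω) => (l.length * G.expectedUtility resp q - U l) / 2
  have key : ∀ n ≤ T, G.runMean resp π n
      (fun l => loss l - w * playPotential B (observed π l)) ≤
      ∑ j ∈ Finset.range n, 2 * B.card * (j : ℝ)⁻¹ := by
    intro n
    induction n with
    | zero => intro _; simp [runMean_zero, loss, U, observed, playPotential, playCount]
    | succ n ih =>
      intro hn
      rw [runMean_succ, Finset.sum_range_succ]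
      refine le_trans ?_ (add_le_add (ih (by omega)) (G.runMean_confidenceFailure_le resp π hB n))
      rw [← runMean_add]
      refine G.runMean_mono resp π fun l hl => ?_
      have hlen := length_observed π l
      rw [← one_mul (_ + _), ← G.sum_stepProb resp (π (observed π l)), Finset.sum_mul]
      refine Finset.sum_le_sum fun y _ => mul_le_mul_of_nonneg_left ?_ (G.stepProb_nonneg resp _ y)
      have hgap := G.gap_le_of_isUCB1 resp hB hπ hq (T := T) (h := observed π l)
        (by omega) y.2
      rw [hlen, hl] at hgap
      simp only [loss, U, observed, List.length_cons, List.map_cons, List.sum_cons]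
      push_cast
      linarith
  have hmean : T * G.expectedUtility resp q - G.expectedTotalUtility resp π T =
      2 * G.runMean resp π T loss := by
    rw [← runMean_const_mul]
    have h1 : G.expectedTotalUtility resp π T = G.runMean resp π T U := rfl
    rw [h1, ← G.runMean_const resp π (T * G.expectedUtility resp q) T, sub_eq_add_neg,
      ← neg_one_mul, ← runMean_const_mul, ← runMean_add]
    refine Finset.sum_congr rfl fun x _ => ?_
    simp only [loss, List.length_ofFn]
    ring
  have hsplit : G.runMean resp π T loss ≤ G.runMean resp π T
      (fun l => (loss l - w * playPotential B (observed π l)) + w * √(B.card * T)) := by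
    refine G.runMean_mono resp π fun l hl => ?_
    have h1 := playPotential_le B (observed π l)
    rw [length_observed, hl] at h1
    linarith [mul_le_mul_of_nonneg_left h1 hw]
  rw [runMean_add, runMean_const] at hsplit
  have hharm : ∑ j ∈ Finset.range T, 2 * (B.card : ℝ) * (j : ℝ)⁻¹ ≤
      2 * B.card * (1 + Real.log T) := by
    rw [← Finset.mul_sum]
    refine mul_le_mul_of_nonneg_left (le_trans ?_ (harmonic_le_one_add_log T)) (by positivity)
    -- Shifting the index only drops the junk term `0⁻¹ = 0` and adds `1 / T`.
    have h1 := Finset.sum_range_succ' (fun j : ℕ => (j : ℝ)⁻¹) T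
    rw [Finset.sum_range_succ] at h1
    simp only [Nat.cast_zero, inv_zero, add_zero] at h1
    have h2 : (0 : ℝ) ≤ (T : ℝ)⁻¹ := by positivity
    unfold harmonic
    push_cast at h1 ⊢
    linarith
  rw [hmean]
  linarith [key T le_rfl]

/-! ### The regret with respect to an optimal non-robust contract -/

theorem nonRobustRegret_le (G : PrincipalAgent Ω Θ A) [Finite A] {δ : ℝ} (hδ : 0 < δ)
    {a₀ aδ : Θ → (Ω → ℝ) → A} (h₀ : G.IsFavorableResponse a₀) (h₁ : G.IsRobustResponse δ aδ)
    {T : ℕ} (hT : 1 ≤ T) {π : ContractPolicy Ω} (hπ : G.IsRegretMinimizer T π) :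
    G.nonRobustRegret a₀ aδ π T ≤
      (18 * 3 ^ Fintype.card Ω + 2) * (T : ℝ) ^ (1 - 1 / (2 * ((Fintype.card Ω : ℝ) + 1))) *
        (1 + Real.log T) + 2 * √δ * T := by
  set m := Fintype.card Ω
  have hTr : (1 : ℝ) ≤ T := by exact_mod_cast hT
  have hT0 : (0 : ℝ) < T := by linarith
  have hL : 0 ≤ Real.log T := Real.log_nonneg hTr
  have hm : (0 : ℝ) < (m : ℝ) + 1 := by positivity
  set ε := (T : ℝ) ^ (-(1 / ((m : ℝ) + 1))) with hε
  set E := (T : ℝ) ^ (1 - 1 / (2 * ((m : ℝ) + 1))) with hE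
  have hε0 : 0 < ε := Real.rpow_pos_of_pos hT0 _
  have hε1 : ε ≤ 1 := Real.rpow_le_one_of_one_le_of_nonpos hTr (by
    rw [neg_nonpos]; positivity)
  have hE0 : 0 < E := Real.rpow_pos_of_pos hT0 _
  obtain ⟨B, hB, hcard⟩ := contractGrid_finite_and_card_le (Ω := Ω) hε0 hε1
  have hBcube : (B : Set (Ω → ℝ)) ⊆ contractCube Ω := by
    rw [hB]; exact contractGrid_subset_contractCube hε0.le
  have hπB : G.IsUCB1 B π := by rw [hB]; exact hπ
  obtain ⟨⟨p, hp, hpopt⟩, -⟩ := G.opt_isGreatest a₀ h₀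
  obtain ⟨q, hq, hpq⟩ := G.exists_mem_contractGrid_expectedUtility_ge hδ hε0 h₀ h₁ hp
  rw [← hB] at hq
  have hucb := G.regret_le_of_isUCB1 aδ hBcube hπB hq T
  have hsqrt : √(δ + ε) ≤ √δ + √ε := by
    refine Real.sqrt_le_iff.2 ⟨by positivity, ?_⟩
    rw [add_sq, Real.sq_sqrt hδ.le, Real.sq_sqrt hε0.le]
    linarith [mul_nonneg (Real.sqrt_nonneg δ) (Real.sqrt_nonneg ε)]
  have hTε : T * √ε = E := by
    rw [Real.sqrt_eq_rpow, hε, ← Real.rpow_mul hT0.le, hE, ← Real.rpow_one_add' hT0.le]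
    · congr 1; field_simp; ring
    · have : 1 + -(1 / ((m : ℝ) + 1)) * (1 / 2) = (2 * m + 1) / (2 * (m + 1)) := by
        field_simp; ring
      rw [this]; positivity
  have hcard' : (B.card : ℝ) ≤ 3 ^ m * (T : ℝ) ^ ((m : ℝ) / (m + 1)) := by
    refine hcard.trans (le_of_eq ?_)
    rw [div_pow, div_eq_mul_inv, hε, ← Real.rpow_natCast ((T : ℝ) ^ _), ← Real.rpow_mul hT0.le,
      ← Real.rpow_neg hT0.le]
    congr 2
    ring
  have h3 : (1 : ℝ) ≤ 3 ^ m := one_le_pow₀ (by norm_num)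
  have hK : (B.card : ℝ) ≤ 3 ^ m * E := by
    refine hcard'.trans (mul_le_mul_of_nonneg_left ?_ (by positivity))
    refine Real.rpow_le_rpow_of_exponent_le hTr ?_
    have : 1 - 1 / (2 * ((m : ℝ) + 1)) - m / (m + 1) = 1 / (2 * (m + 1)) := by field_simp; ring
    have h4 : (0 : ℝ) ≤ 1 / (2 * ((m : ℝ) + 1)) := by positivity
    linarith
  have hKT : √(B.card * T) ≤ 3 ^ m * E := by
    refine Real.sqrt_le_iff.2 ⟨by positivity, ?_⟩
    have hEE : E ^ 2 = (T : ℝ) ^ ((m : ℝ) / (m + 1)) * T := by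
      rw [hE, ← Real.rpow_natCast, ← Real.rpow_mul hT0.le, ← Real.rpow_add_one hT0.ne']
      congr 1
      push_cast
      field_simp
      ring
    calc (B.card : ℝ) * T ≤ 3 ^ m * (T : ℝ) ^ ((m : ℝ) / (m + 1)) * T := by gcongr
      _ = 3 ^ m * E ^ 2 := by rw [hEE]; ring
      _ ≤ (3 ^ m) ^ 2 * E ^ 2 := by gcongr; exact le_self_pow₀ h3 (by norm_num)
      _ = _ := by ring
  have hsqL : √(2 * Real.log T) ≤ 1 + Real.log T :=
    Real.sqrt_le_iff.2 ⟨by positivity, by nlinarith⟩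
  have hU : (1 + 6 * √(2 * Real.log T)) * √(B.card * T) ≤
      (7 * (1 + Real.log T)) * (3 ^ m * E) :=
    mul_le_mul (by linarith) hKT (Real.sqrt_nonneg _) (by positivity)
  have hV : 2 * B.card * (1 + Real.log T) ≤ 2 * (3 ^ m * E) * (1 + Real.log T) := by gcongr
  have hgrid : T * G.opt a₀ ≤ T * G.expectedUtility aδ q + 2 * √δ * T + 2 * E := by
    rw [← hpopt, ← hTε]
    have := mul_le_mul_of_nonneg_left (hpq.trans (add_le_add_right
      (mul_le_mul_of_nonneg_left hsqrt two_pos.le) _)) hT0.le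
    linarith
  have hEL : 2 * E ≤ 2 * E * (1 + Real.log T) :=
    le_mul_of_one_le_right (by positivity) (by linarith)
  unfold nonRobustRegret
  linarith

/-- The regret is nonnegative: worst-case approximate responses never beat the benchmark. -/
theorem nonRobustRegret_nonneg (G : PrincipalAgent Ω Θ A) [Finite A] {δ : ℝ} (hδ : 0 < δ)
    {a₀ aδ : Θ → (Ω → ℝ) → A} (h₀ : G.IsFavorableResponse a₀) (h₁ : G.IsRobustResponse δ aδ)
    {T : ℕ} {π : ContractPolicy Ω} (hπ : G.IsRegretMinimizer T π) :
    0 ≤ G.nonRobustRegret a₀ aδ π T := by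
  have hcube : ∀ h, π h ∈ contractCube Ω := fun h =>
    contractGrid_subset_contractCube (Real.rpow_nonneg (Nat.cast_nonneg T) _) (hπ h).1
  have hU : ∀ l : List (Θ × Ω), ((observed π l).map fun y => G.expectedUtility aδ y.1).sum ≤
      l.length * G.opt a₀ := by
    intro l
    induction l with
    | nil => simp [observed]
    | cons y l ih =>
      have := G.expectedUtility_robust_le_opt hδ h₀ h₁ (hcube (observed π l))
      simp only [observed, List.map_cons, List.sum_cons, List.length_cons]
      push_cast
      linarith
  have h2 : G.runMean aδ π T (fun l => ((observed π l).map fun y => G.expectedUtility aδ y.1).sum) ≤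
      G.runMean aδ π T fun _ => T * G.opt a₀ :=
    G.runMean_mono aδ π fun l hl => hl ▸ hU l
  rw [runMean_const] at h2
  exact sub_nonneg.2 h2

/-- The bound on the average regret for `δ = T^(-α)` vanishes as the horizon grows. -/
theorem tendsto_average_regret_bound (C : ℝ) {β α : ℝ} (hβ : 0 < β) (hα : 0 < α) :
    Filter.Tendsto (fun T : ℕ => C * (T : ℝ) ^ (-β) * (1 + Real.log T) + 2 * √((T : ℝ) ^ (-α)))
      Filter.atTop (nhds 0) := by
  have h1 : Filter.Tendsto (fun x : ℝ => x ^ (-β)) Filter.atTop (nhds 0) :=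
    tendsto_rpow_neg_atTop hβ
  have h2 : Filter.Tendsto (fun x : ℝ => x ^ (-β) * Real.log x) Filter.atTop (nhds 0) := by
    refine ((isLittleO_log_rpow_atTop hβ).tendsto_div_nhds_zero).congr' ?_
    filter_upwards [Filter.eventually_ge_atTop 0] with x hx
    rw [Real.rpow_neg hx, div_eq_inv_mul]
  have h3 : Filter.Tendsto (fun x : ℝ => √(x ^ (-α))) Filter.atTop (nhds 0) := by
    have := (tendsto_rpow_neg_atTop hα).sqrt
    rwa [Real.sqrt_zero] at this
  have h4 := ((h1.add h2).const_mul C).add (h3.const_mul 2)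
  simp only [add_zero, mul_zero] at h4
  refine (h4.comp tendsto_natCast_atTop_atTop).congr fun x => ?_
  simp only [Function.comp_apply]
  ring

end PrincipalAgent

theorem mainTheorem5 :
    (∃ k : ℕ, ∀ m : ℕ, ∃ C : ℝ,
      ∀ (Ω Θ A : Type*) [Fintype Ω] [Fintype Θ] [Fintype A], Fintype.card Ω = m →
      ∀ (G : PrincipalAgent Ω Θ A) (δ : ℝ), 0 < δ → δ < 1 →
      ∀ a₀ aδ : Θ → (Ω → ℝ) → A, G.IsFavorableResponse a₀ → G.IsRobustResponse δ aδ →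
      ∀ (T : ℕ) (π : ContractPolicy Ω), 1 ≤ T → G.IsRegretMinimizer T π →
        G.nonRobustRegret a₀ aδ π T ≤
          C * (T : ℝ) ^ (1 - 1 / (2 * ((m : ℝ) + 1))) * (1 + Real.log T) ^ k
            + 2 * √δ * T) ∧
    (∀ (m : ℕ) (α : ℝ), 0 < α → ∀ η : ℝ, 0 < η → ∃ T₀ : ℕ,
      ∀ (Ω Θ A : Type*) [Fintype Ω] [Fintype Θ] [Fintype A], Fintype.card Ω = m →
      ∀ (G : PrincipalAgent Ω Θ A) (T : ℕ), T₀ ≤ T →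
      ∀ a₀ aδ : Θ → (Ω → ℝ) → A, G.IsFavorableResponse a₀ →
        G.IsRobustResponse ((T : ℝ) ^ (-α)) aδ →
      ∀ π : ContractPolicy Ω, G.IsRegretMinimizer T π →
        |G.nonRobustRegret a₀ aδ π T| ≤ η * T) := by
  refine ⟨⟨1, fun m => ⟨18 * 3 ^ m + 2, ?_⟩⟩, fun m α hα η hη => ?_⟩
  · intro Ω Θ A _ _ _ hm G δ hδ _ a₀ aδ h₀ h₁ T π hT hπ
    subst hm
    rw [pow_one]
    exact G.nonRobustRegret_le hδ h₀ h₁ hT hπ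
  · have hβ : (0 : ℝ) < 1 / (2 * ((m : ℝ) + 1)) := by positivity
    obtain ⟨T₀, hT₀⟩ := Filter.eventually_atTop.1
      ((PrincipalAgent.tendsto_average_regret_bound (18 * 3 ^ m + 2) hβ hα).eventually
        (ge_mem_nhds hη))
    refine ⟨max T₀ 1, ?_⟩
    intro Ω Θ A _ _ _ hm G T hT a₀ aδ h₀ h₁ π hπ
    subst hm
    have hT1 : 1 ≤ T := (le_max_right _ _).trans hT
    have hT0 : (0 : ℝ) < T := by exact_mod_cast hT1
    have hδ : 0 < (T : ℝ) ^ (-α) := Real.rpow_pos_of_pos hT0 _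
    rw [abs_of_nonneg (G.nonRobustRegret_nonneg hδ h₀ h₁ hπ)]
    refine (G.nonRobustRegret_le hδ h₀ h₁ hT1 hπ).trans ?_
    rw [sub_eq_add_neg 1, Real.rpow_add hT0, Real.rpow_one]
    have := mul_le_mul_of_nonneg_right (hT₀ T ((le_max_left _ _).trans hT)) hT0.le
    linarith
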